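/- Let $E$ be a finite-dimensional real normed space, with dual $E^*$ and closed dual unit ball $B_1^*\subset E^*$ (in Euclidean space, $B_1^*$ is the unit ball $B_1$). Averages over $B_1^*$ are taken with respect to volume (Haar) measure on $E^*$. **Requests and work function.** Let $t\ge 1$ and let requests $1,\dots,t$ be given, the $n$-th request being a non-empty closed convex set $K_n\subseteq E$ together with a convex service cost $f_n:E\to[0,\infty)$. (Chasing convex bodies is the case $f_n\equiv 0$; chasing convex functions is the case $K_n=E$.) The work function is $$W_t(y)=\inf\Big\{\sum_{n=1}^{t}\big(\|x_n-x_{n-1}\|+f_n(x_n)\big)+\|y-x_t\| \;:\; x_0=0,\ x_n\in K_n \text{ for } 1\le n\le t\Big\}.$$ For a non-empty closed convex set $S$, let $W_t^{S}$ denote the work function at time $t+1$ when the request at time $t+1$ is $K_{t+1}=S$ (with $f_{t+1}\equiv 0$). For real $R$ put $\Omega_{t,R}=\{x\in E: W_t(x)\le R\}$. **Steiner points.** For a compact convex non-empty set $S$, the Steiner point $s(S)$ is the average over $v\in B_1^*$ of the point $\arg\max_{x\in S}v(x)$. For a convex function $W:E\to[0,\infty)$ with $\inf_w (W(w)-v(w))$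 finite for all $v\in B_1^*$, the functional Steiner point $s(W)$ is the average over $v\in B_1^*$ of the conjugate point $v^*=\arg\min_{w\in E}(W(w)-v(w))$. **Theorem.** For every $R\ge \min_x W_t(x)$, $$s(\Omega_{t,R})=s\big(W_t^{\Omega_{t,R}}\big)\in K_t .$$ If moreover $K_s\subseteq\Omega_{t,R}$ for all $1\le s\le t$, then $s(\Omega_{t,R})=s(W_t)$. In each case the averages are well defined: for almost every $v\in B_1^*$ the maximizer (respectively minimizer) exists and is unique, and it is an integrable function of $v$. -/

import Mathlib

open MeasureTheory

noncomputable section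

namespace ConvexChasing

variable {E : Type*} [NormedAddCommGroup E] [NormedSpace ℝ E]

/-! ### Work functions

The request at time `n ≥ 1` is a set `K n` together with a service cost `f n`: the chosen point
`x n` must lie in `K n`, and `f n (x n)` is paid on top of the movement. Chasing convex bodies is
the case `f n = 0`; chasing convex functions is the case `K n = Set.univ`. The value of `K` and `f`
at time `0` is never used. -/

/-- The sequences of positions `x 0 = 0, x 1 ∈ K 1, …, x t ∈ K t`. -/
def Paths (K : ℕ → Set E) (t : ℕ) : Set (ℕ → E) :=
  {x | x 0 = 0 ∧ ∀ n, 1 ≤ n → n ≤ t → x n ∈ K n}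

/-- Movement plus service cost of the positions `x 0, …, x t`, followed by a move to `y`. -/
def pathCost (f : ℕ → E → ℝ) (t : ℕ) (x : ℕ → E) (y : E) : ℝ :=
  (∑ n ∈ Finset.range t, (‖x (n + 1) - x n‖ + f (n + 1) (x (n + 1)))) + ‖y - x t‖

/-- The work function `W_t`: the least cost of serving the first `t` requests, starting at `0` and
ending at `y`. -/
def workFunction (K : ℕ → Set E) (f : ℕ → E → ℝ) (t : ℕ) (y : E) : ℝ :=
  ⨅ x : Paths K t, pathCost f t x y

/-- The level set `Ω_{t,R} = {W_t ≤ R}`. -/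
def levelSet (K : ℕ → Set E) (f : ℕ → E → ℝ) (t : ℕ) (R : ℝ) : Set E :=
  {x | workFunction K f t x ≤ R}

/-- `W_t^S`: the work function at time `t + 1` when the request at time `t + 1` is the body `S`. -/
def workFunctionAfter (K : ℕ → Set E) (f : ℕ → E → ℝ) (t : ℕ) (S : Set E) : E → ℝ :=
  workFunction (Function.update K (t + 1) S) (Function.update f (t + 1) 0) (t + 1)

/-! ### Steiner points

Directions range over the unit ball of the dual space, averages are with respect to the volume
(Haar) measure of the dual space; the average does not depend on its normalization. -/

/-- `f_K(v)`, a maximizer of `v` over `K`. -/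
def extremalPoint (K : Set E) (v : StrongDual ℝ E) : E :=
  Classical.epsilon fun x => x ∈ K ∧ IsMaxOn v K x

/-- `v^*`, a minimizer of `w ↦ W w - v w`. -/
def conjugatePoint (W : E → ℝ) (v : StrongDual ℝ E) : E :=
  Classical.epsilon fun x => IsMinOn (fun w => W w - v w) Set.univ x

variable [FiniteDimensional ℝ E]

/-- The volume measure of the dual space, restricted to the dual unit ball. -/
def dualBallMeasure (E : Type*) [NormedAddCommGroup E] [NormedSpace ℝ E] [FiniteDimensional ℝ E] :
    Measure (StrongDual ℝ E) :=
  (Measure.addHaar : Measure (StrongDual ℝ E)).restrict (Metric.closedBall 0 1)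

/-- The Steiner point of `K`: the average of the extremal point over the dual unit ball. -/
def steinerPoint (K : Set E) : E :=
  ⨍ v, extremalPoint K v ∂(dualBallMeasure E)

/-- The functional Steiner point of `W`: the average of the conjugate point over the dual unit
ball. -/
def functionalSteinerPoint (W : E → ℝ) : E :=
  ⨍ v, conjugatePoint W v ∂(dualBallMeasure E)

/-- The average defining the Steiner point of `K` is meaningful: the extremal point exists and is
unique in almost every direction, and it is integrable. -/
def SteinerWellDefined (K : Set E) : Prop :=
  (∀ᵐ v : StrongDual ℝ E ∂(dualBallMeasure E), ∃! x, x ∈ K ∧ IsMaxOn v K x) ∧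
    Integrable (extremalPoint K) (dualBallMeasure E)

/-- The average defining the functional Steiner point of `W` is meaningful: the conjugate point
exists and is unique for almost every `v`, and it is integrable. -/
def FunctionalSteinerWellDefined (W : E → ℝ) : Prop :=
  (∀ᵐ v : StrongDual ℝ E ∂(dualBallMeasure E), ∃! x, IsMinOn (fun w => W w - v w) Set.univ x) ∧
    Integrable (conjugatePoint W) (dualBallMeasure E)

end ConvexChasing

end

section

open Metric Set
open scoped NNReal Topology

/-! Write `W` for the work function and `Ω` for `{W ≤ R}`. For `‖v‖ < 1`, the point entering the
Steiner point of `Ω` maximizes `v - R` over `Ω`, and the conjugate point of `W_t^Ω` maximizes `v -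
W` over `Ω` (`isMinOn_iff`). Almost everywhere both are derivatives at `v` of the conjugate
functions `sup_Ω (v - R)` and `sup_Ω (v - W)` (`fderiv_conjugateOn`). These agree on the dual unit
sphere because `W` is 1-Lipschitz (`conjugateOn_levelSet_eq`), so by integration by parts their
derivatives have the same mean over the ball. Since `W` is an infimal convolution of the norm over
`K_t`, minimizers of `W - v` lie in `K_t` when `‖v‖ < 1`; this puts the average in `K_t` and, if
`K_t ⊆ Ω`, identifies the global minimizers with those over `Ω`. -/

/-- The derivative of a Lipschitz function vanishing on the unit sphere has zero average over the
unit ball, in every direction. -/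
theorem LipschitzWith.setIntegral_lineDeriv_closedBall_eq_zero {F : Type*} [NormedAddCommGroup F]
    [NormedSpace ℝ F] [FiniteDimensional ℝ F] [MeasurableSpace F] [BorelSpace F]
    {μ : Measure F} [μ.IsAddHaarMeasure] {C : ℝ≥0} {h : F → ℝ} (hh : LipschitzWith C h)
    (h0 : ∀ v, ‖v‖ = 1 → h v = 0) (φ : F) :
    ∫ v in closedBall 0 1, lineDeriv ℝ h v φ ∂μ = 0 := by
  set H : F → ℝ := (closedBall 0 1).indicator h with hH
  -- The segment from `x` to `y` meets the sphere, where `h` vanishes; hence extending `h` by zero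
  -- keeps the Lipschitz constant.
  have hcross : ∀ x y : F, ‖x‖ ≤ 1 → 1 < ‖y‖ → |h x| ≤ C * dist x y := by
    intro x y hx hy
    have hcont : ContinuousOn (fun s : ℝ => ‖x + s • (y - x)‖) (Icc 0 1) := by fun_prop
    obtain ⟨s, hs, hs1⟩ : (1 : ℝ) ∈ (fun s : ℝ => ‖x + s • (y - x)‖) '' Icc 0 1 :=
      intermediate_value_Icc zero_le_one hcont (by simpa using ⟨hx, hy.le⟩)
    have h1 := hh.dist_le_mul x (x + s • (y - x))
    rw [h0 _ hs1, Real.dist_eq, sub_zero] at h1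
    refine h1.trans ?_
    gcongr
    rw [dist_self_add_right, norm_smul, dist_comm, dist_eq_norm, Real.norm_of_nonneg hs.1]
    exact mul_le_of_le_one_left (norm_nonneg _) hs.2
  have hHlip : LipschitzWith C H := by
    refine LipschitzWith.of_dist_le_mul fun x y => ?_
    by_cases hx : x ∈ closedBall (0 : F) 1 <;> by_cases hy : y ∈ closedBall (0 : F) 1
    · simpa [hH, hx, hy] using hh.dist_le_mul x y
    · simp only [hH, indicator_of_mem hx, indicator_of_notMem hy, Real.dist_eq, sub_zero]
      exact hcross x y (by simpa using hx) (by simpa using hy)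
    · simp only [hH, indicator_of_mem hy, indicator_of_notMem hx, Real.dist_eq, zero_sub, abs_neg]
      rw [dist_comm]
      exact hcross y x (by simpa using hy) (by simpa using hx)
    · simpa [hH, indicator_of_notMem hx, indicator_of_notMem hy] using
        mul_nonneg C.2 dist_nonneg
  have hHsupp : HasCompactSupport H :=
    HasCompactSupport.of_support_subset_isCompact (isCompact_closedBall 0 1)
      support_indicator_subset
  have hzero : ∫ v, lineDeriv ℝ H v φ ∂μ = 0 := by
    -- Integration by parts against the constant 1; it reverses the direction, hence `-φ`.
    have := (LipschitzWith.const' (α := F) (1 : ℝ) (K := 0)).integral_lineDeriv_mul_eq (μ := μ)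
      hHlip hHsupp (-φ)
    simpa [lineDeriv] using this.symm
  rw [← hzero, ← integral_indicator isClosed_closedBall.measurableSet]
  refine integral_congr_ae ?_
  have hsph : ∀ᵐ v ∂μ, v ∉ sphere (0 : F) 1 :=
    measure_eq_zero_iff_ae_notMem.1 (Measure.addHaar_sphere_of_ne_zero μ 0 one_ne_zero)
  filter_upwards [hsph] with v hv
  rcases lt_trichotomy ‖v‖ 1 with hlt | heq | hgt
  · rw [indicator_of_mem (by simpa using hlt.le)]
    refine (Filter.EventuallyEq.lineDeriv_eq ?_).symm
    filter_upwards [isOpen_ball.mem_nhds (show v ∈ ball (0 : F) 1 by simpa using hlt)] with w hw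
    exact indicator_of_mem (ball_subset_closedBall hw) h
  · exact absurd (by simpa using heq) hv
  · rw [indicator_of_notMem (by simpa using hgt)]
    have : H =ᶠ[𝓝 v] fun _ => 0 := by
      filter_upwards [isClosed_closedBall.isOpen_compl.mem_nhds
        (show v ∈ (closedBall (0 : F) 1)ᶜ by simpa using hgt)] with w hw
      exact indicator_of_notMem hw h
    rw [this.lineDeriv_eq]
    simp [lineDeriv]

namespace ConvexChasing

variable {E : Type*} [NormedAddCommGroup E]

/-! ### Infimal convolution with the norm -/

/-- `V` is the infimal convolution of the norm with the restriction of `g` to `S`. -/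
def IsInfConvNorm (S : Set E) (g V : E → ℝ) : Prop :=
  ∀ y, IsGLB ((fun x => g x + ‖y - x‖) '' S) (V y)

namespace IsInfConvNorm

variable {S : Set E} {g V : E → ℝ} (hV : IsInfConvNorm S g V)
include hV

theorem le {x : E} (hx : x ∈ S) (y : E) : V y ≤ g x + ‖y - x‖ :=
  (hV y).1 ⟨x, hx, rfl⟩

theorem le_self {x : E} (hx : x ∈ S) : V x ≤ g x := by
  simpa using hV.le hx x

theorem le_of_forall_le {b : ℝ} {y : E} (h : ∀ x ∈ S, b ≤ g x + ‖y - x‖) : b ≤ V y :=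
  (hV y).2 (by rintro _ ⟨x, hx, rfl⟩; exact h x hx)

theorem exists_lt {b : ℝ} {y : E} (h : V y < b) : ∃ x ∈ S, g x + ‖y - x‖ < b := by
  by_contra! hcon
  exact absurd (hV.le_of_forall_le hcon) (not_le.2 h)

theorem lipschitzWith : LipschitzWith 1 V := by
  refine LipschitzWith.of_le_add fun y z => ?_
  rw [← sub_le_iff_le_add]
  refine hV.le_of_forall_le fun x hx => ?_
  have h1 := hV.le hx y
  have h2 := norm_sub_le_norm_sub_add_norm_sub y z x
  rw [dist_eq_norm]
  linarith

end IsInfConvNorm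

/-! ### Recursion for the work function -/

theorem pathCost_succ (f : ℕ → E → ℝ) (t : ℕ) (x : ℕ → E) (y : E) :
    pathCost f (t + 1) x y =
      pathCost f t x (x (t + 1)) + f (t + 1) (x (t + 1)) + ‖y - x (t + 1)‖ := by
  simp only [pathCost, Finset.sum_range_succ]
  ring

theorem pathCost_congr {f f' : ℕ → E → ℝ} {t : ℕ} {x x' : ℕ → E}
    (hf : ∀ n, 1 ≤ n → n ≤ t → f n = f' n) (hx : ∀ n ≤ t, x n = x' n) (y : E) :
    pathCost f t x y = pathCost f' t x' y := by
  simp only [pathCost, hx t le_rfl]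
  congr 1
  refine Finset.sum_congr rfl fun n hn => ?_
  have hn' : n + 1 ≤ t := Finset.mem_range.1 hn
  rw [hx _ hn', hx n (by omega), hf (n + 1) (by omega) hn']

theorem workFunction_congr {K K' : ℕ → Set E} {f f' : ℕ → E → ℝ} {t : ℕ}
    (hK : ∀ n, 1 ≤ n → n ≤ t → K n = K' n) (hf : ∀ n, 1 ≤ n → n ≤ t → f n = f' n) :
    workFunction K f t = workFunction K' f' t := by
  have hP : Paths K t = Paths K' t := by
    ext x
    refine and_congr_right fun _ => forall_congr' fun n => forall_congr' fun h1 =>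
      forall_congr' fun h2 => ?_
    rw [hK n h1 h2]
  funext y
  rw [workFunction, workFunction, hP]
  exact iInf_congr fun x => pathCost_congr hf (fun _ _ => rfl) y

theorem Paths.mono {K : ℕ → Set E} {t : ℕ} {x : ℕ → E} (hx : x ∈ Paths K (t + 1)) :
    x ∈ Paths K t :=
  ⟨hx.1, fun n h1 h2 => hx.2 n h1 (by omega)⟩

/-- Triangle inequality from the start at 0. This bounds the infimum below and makes the work
function coercive, so its level sets are bounded. -/
theorem norm_le_pathCost {K : ℕ → Set E} {f : ℕ → E → ℝ} {t : ℕ}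
    (hf : ∀ n, 1 ≤ n → n ≤ t → ∀ x, 0 ≤ f n x) {x : ℕ → E} (hx : x ∈ Paths K t) (y : E) :
    ‖y‖ ≤ pathCost f t x y := by
  induction t generalizing y with
  | zero => simp [pathCost, hx.1]
  | succ t ih =>
    rw [pathCost_succ]
    have h1 := ih (fun n h1 h2 => hf n h1 (by omega)) (Paths.mono hx) (x (t + 1))
    have h2 := hf (t + 1) (by omega) le_rfl (x (t + 1))
    have h3 := norm_le_norm_add_norm_sub' y (x (t + 1))
    linarith

theorem Paths.nonempty {K : ℕ → Set E} {t : ℕ} (hK : ∀ n, 1 ≤ n → n ≤ t → (K n).Nonempty) :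
    (Paths K t).Nonempty := by
  classical
  refine ⟨fun n => if h : 1 ≤ n ∧ n ≤ t then (hK n h.1 h.2).some else 0, by simp, fun n h1 h2 => ?_⟩
  simp only [h1, h2, and_self, dite_true]
  exact (hK n h1 h2).some_mem

theorem isGLB_workFunction {K : ℕ → Set E} {f : ℕ → E → ℝ} {t : ℕ}
    (hK : ∀ n, 1 ≤ n → n ≤ t → (K n).Nonempty) (hf : ∀ n, 1 ≤ n → n ≤ t → ∀ x, 0 ≤ f n x)
    (y : E) : IsGLB ((fun x => pathCost f t x y) '' Paths K t) (workFunction K f t y) := by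
  have : Nonempty (Paths K t) := (Paths.nonempty hK).to_subtype
  rw [image_eq_range]
  refine isGLB_ciInf ⟨‖y‖, ?_⟩
  rintro _ ⟨x, rfl⟩
  exact norm_le_pathCost hf x.2 y

theorem norm_le_workFunction {K : ℕ → Set E} {f : ℕ → E → ℝ} {t : ℕ}
    (hK : ∀ n, 1 ≤ n → n ≤ t → (K n).Nonempty) (hf : ∀ n, 1 ≤ n → n ≤ t → ∀ x, 0 ≤ f n x)
    (y : E) : ‖y‖ ≤ workFunction K f t y := by
  refine (isGLB_workFunction hK hf y).2 ?_
  rintro _ ⟨x, hx, rfl⟩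
  exact norm_le_pathCost hf hx y

theorem isInfConvNorm_workFunction_succ {K : ℕ → Set E} {f : ℕ → E → ℝ} {t : ℕ}
    (hK : ∀ n, 1 ≤ n → n ≤ t + 1 → (K n).Nonempty)
    (hf : ∀ n, 1 ≤ n → n ≤ t + 1 → ∀ x, 0 ≤ f n x) :
    IsInfConvNorm (K (t + 1)) (fun x => workFunction K f t x + f (t + 1) x)
      (workFunction K f (t + 1)) := by
  have hG := isGLB_workFunction hK hf
  have hG' := isGLB_workFunction (t := t) (fun n h1 h2 => hK n h1 (by omega))
    (fun n h1 h2 => hf n h1 (by omega))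
  intro y
  constructor
  · rintro _ ⟨z, hz, rfl⟩
    change workFunction K f (t + 1) y ≤ workFunction K f t z + f (t + 1) z + ‖y - z‖
    rw [add_assoc, ← sub_le_iff_le_add]
    refine (hG' z).2 ?_
    rintro _ ⟨x, hx, rfl⟩
    -- Positions after time `t` are unconstrained, so `x` can be redirected through `z`.
    have hmem : Function.update x (t + 1) z ∈ Paths K (t + 1) := by
      refine ⟨by simpa using hx.1, fun n h1 h2 => ?_⟩
      rcases h2.lt_or_eq with h | rfl
      · rw [Function.update_of_ne h.ne]
        exact hx.2 n h1 (by omega)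
      · simpa using hz
    have hle := (hG y).1 ⟨_, hmem, rfl⟩
    simp only [pathCost_succ, Function.update_self] at hle
    rw [pathCost_congr (f' := f) (x' := x) (fun _ _ _ => rfl)
      (fun n hn => Function.update_of_ne (by omega) _ _)] at hle
    change workFunction K f (t + 1) y - _ ≤ pathCost f t x z
    linarith
  · intro b hb
    refine (hG y).2 ?_
    rintro _ ⟨x, hx, rfl⟩
    have h1 := hb ⟨x (t + 1), hx.2 _ (by omega) le_rfl, rfl⟩
    have h2 := (hG' (x (t + 1))).1 ⟨x, Paths.mono hx, rfl⟩
    simp only [pathCost_succ] at h1 h2 ⊢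
    linarith

theorem isInfConvNorm_workFunctionAfter {K : ℕ → Set E} {f : ℕ → E → ℝ} {t : ℕ}
    (hK : ∀ n, 1 ≤ n → n ≤ t → (K n).Nonempty) (hf : ∀ n, 1 ≤ n → n ≤ t → ∀ x, 0 ≤ f n x)
    {S : Set E} (hS : S.Nonempty) :
    IsInfConvNorm S (workFunction K f t) (workFunctionAfter K f t S) := by
  have hW : workFunction (Function.update K (t + 1) S) (Function.update f (t + 1) 0) t =
      workFunction K f t :=
    workFunction_congr (fun n _ h => Function.update_of_ne (by omega) _ _)
      (fun n _ h => Function.update_of_ne (by omega) _ _)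
  have := isInfConvNorm_workFunction_succ (K := Function.update K (t + 1) S)
    (f := Function.update f (t + 1) 0) (t := t) ?_ ?_
  · simpa [hW, workFunctionAfter] using this
  · intro n h1 h2
    rcases h2.lt_or_eq with h | rfl
    · rw [Function.update_of_ne h.ne]
      exact hK n h1 (by omega)
    · simpa using hS
  · intro n h1 h2 x
    rcases h2.lt_or_eq with h | rfl
    · rw [Function.update_of_ne h.ne]
      exact hf n h1 (by omega) x
    · simp

variable [NormedSpace ℝ E]

/-! ### Minimizers of infimal convolutions with the norm -/

theorem apply_sub_le_norm_mul (v : StrongDual ℝ E) (x y : E) : v y - v x ≤ ‖v‖ * ‖y - x‖ := by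
  rw [← map_sub]
  exact (le_abs_self _).trans (v.le_opNorm _)

theorem apply_sub_le_norm {v : StrongDual ℝ E} (hv : ‖v‖ ≤ 1) (x y : E) :
    v y - v x ≤ ‖y - x‖ :=
  (apply_sub_le_norm_mul v x y).trans (mul_le_of_le_one_left (norm_nonneg _) hv)

namespace IsInfConvNorm

variable {S : Set E} {g V : E → ℝ} (hV : IsInfConvNorm S g V)
include hV

/-- A minimizer of `V - v` over a level set of `V` lies in `S`. -/
theorem mem_of_isMaxOn_levelSet (hS : IsClosed S) {v : StrongDual ℝ E} (hv : ‖v‖ < 1) {R : ℝ}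
    {y : E} (hyR : V y ≤ R) (hy : IsMaxOn (fun z => v z - V z) {z | V z ≤ R} y) : y ∈ S := by
  refine (Metric.mem_of_closed' hS).2 fun ε hε => ?_
  have hv' : 0 < 1 - ‖v‖ := sub_pos.2 hv
  -- If `‖y - x‖ ≥ ε`, going from `y` to `x` lowers `V` by more than `‖y - x‖ - (1 - ‖v‖) * ε` and
  -- `v` by at most `‖v‖ * ‖y - x‖`, contradicting maximality.
  obtain ⟨x, hxS, hx⟩ := hV.exists_lt (lt_add_of_pos_right (V y) (mul_pos hv' hε))
  refine ⟨x, hxS, ?_⟩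
  by_contra! hcon
  rw [dist_eq_norm] at hcon
  have hδ : (1 - ‖v‖) * ε ≤ ε := mul_le_of_le_one_left hε.le (by linarith [norm_nonneg v])
  have hVx := hV.le_self hxS
  have hmax : v x - V x ≤ v y - V y := hy (show V x ≤ R by linarith)
  have hvy := apply_sub_le_norm_mul v x y
  have := mul_le_mul_of_nonneg_left hcon hv'.le
  linarith

/-- As `g` is 1-Lipschitz, `V = g` on `S`. Leaving `S` costs the distance moved, and `v` gains no
more than that. -/
theorem isMinOn_iff (hS : IsClosed S) (hg : LipschitzWith 1 g) {v : StrongDual ℝ E} (hv : ‖v‖ < 1)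
    {y : E} : IsMinOn (fun w => V w - v w) univ y ↔
      y ∈ S ∧ IsMaxOn (fun w => v w - g w) S y := by
  have hgV : ∀ z, g z ≤ V z := fun z => hV.le_of_forall_le fun x _ => by
    simpa [dist_eq_norm] using hg.le_add_mul z x
  constructor
  · intro hy
    have hyS : y ∈ S := by
      refine hV.mem_of_isMaxOn_levelSet hS hv le_rfl fun z _ => ?_
      have : V y - v y ≤ V z - v z := hy (mem_univ z)
      change v z - V z ≤ v y - V y
      linarith
    refine ⟨hyS, fun x hx => ?_⟩
    have h1 : V y - v y ≤ V x - v x := hy (mem_univ x)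
    have h2 := hgV y
    have h3 := hV.le_self hx
    change v x - g x ≤ v y - g y
    linarith
  · rintro ⟨hyS, hy⟩ z -
    change V y - v y ≤ V z - v z
    rw [le_sub_iff_add_le]
    refine hV.le_of_forall_le fun x hx => ?_
    have h1 : v x - g x ≤ v y - g y := hy hx
    have h2 := hV.le_self hyS
    have h3 := apply_sub_le_norm hv.le x z
    linarith

/-- Here `g` need not be Lipschitz, so `V` itself serves as the cost on the level set. -/
theorem isMinOn_iff_levelSet (hS : IsClosed S) {R : ℝ} (hSR : S ⊆ {z | V z ≤ R})
    {v : StrongDual ℝ E} (hv : ‖v‖ < 1) {y : E} :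
    IsMinOn (fun w => V w - v w) univ y ↔
      y ∈ {z | V z ≤ R} ∧ IsMaxOn (fun w => v w - V w) {z | V z ≤ R} y := by
  constructor
  · intro hy
    have hmax : ∀ T : Set E, IsMaxOn (fun w => v w - V w) T y := fun T z _ => by
      have : V y - v y ≤ V z - v z := hy (mem_univ z)
      change v z - V z ≤ v y - V y
      linarith
    exact ⟨hSR (hV.mem_of_isMaxOn_levelSet hS hv le_rfl (hmax _)), hmax _⟩
  · rintro ⟨-, hy⟩ z -
    change V y - v y ≤ V z - v z
    rw [le_sub_iff_add_le]
    refine hV.le_of_forall_le fun x hx => ?_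
    have h1 : v x - V x ≤ v y - V y := hy (hSR hx)
    have h2 := hV.le_self hx
    have h3 := apply_sub_le_norm hv.le x z
    linarith

end IsInfConvNorm

/-! ### Conjugates over compact sets -/

/-- `sup_{x ∈ S} (v x - c x)`; for `c = 0` this is the support function of `S`. -/
noncomputable def conjugateOn (c : E → ℝ) (S : Set E) (v : StrongDual ℝ E) : ℝ :=
  ⨆ x : S, (v x - c x)

theorem conjugateOn_eq {c : E → ℝ} {S : Set E} {v : StrongDual ℝ E} {x : E} (hxS : x ∈ S)
    (hx : IsMaxOn (fun y => v y - c y) S x) : conjugateOn c S v = v x - c x :=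
  hx.iSup_eq hxS

theorem exists_isMaxOn_sub {c : E → ℝ} {S : Set E} (hS : IsCompact S) (hne : S.Nonempty)
    (hc : ContinuousOn c S) (v : StrongDual ℝ E) :
    ∃ x ∈ S, IsMaxOn (fun y => v y - c y) S x :=
  hS.exists_isMaxOn hne (v.continuous.continuousOn.sub hc)

theorem le_conjugateOn {c : E → ℝ} {S : Set E} (hS : IsCompact S) (hc : ContinuousOn c S)
    (v : StrongDual ℝ E) {x : E} (hx : x ∈ S) : v x - c x ≤ conjugateOn c S v := by
  obtain ⟨y, hyS, hy⟩ := exists_isMaxOn_sub hS ⟨x, hx⟩ hc v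
  rw [conjugateOn_eq hyS hy]
  exact hy hx

theorem exists_lipschitzWith_conjugateOn {S : Set E} (hS : IsCompact S) (hne : S.Nonempty) :
    ∃ C : ℝ≥0, ∀ c : E → ℝ, ContinuousOn c S → LipschitzWith C (conjugateOn c S) := by
  obtain ⟨M, hM⟩ := hS.isBounded.exists_norm_le
  refine ⟨M.toNNReal, fun c hc => LipschitzWith.of_le_add_mul _ fun v w => ?_⟩
  obtain ⟨x, hxS, hx⟩ := exists_isMaxOn_sub hS hne hc v
  have hM0 : 0 ≤ M := (norm_nonneg x).trans (hM x hxS)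
  rw [conjugateOn_eq hxS hx, Real.coe_toNNReal M hM0]
  have h1 := le_conjugateOn hS hc w hxS
  have h2 : (v - w) x ≤ ‖v - w‖ * ‖x‖ := (le_abs_self _).trans ((v - w).le_opNorm x)
  have h3 : ‖v - w‖ * ‖x‖ ≤ ‖v - w‖ * M := by gcongr; exact hM x hxS
  rw [dist_eq_norm]
  simp only [sub_apply] at h2
  linarith [mul_comm M ‖v - w‖]

/-- Envelope argument: the affine function `w ↦ w x - c x` touches the conjugate from below at `v`.
-/
theorem fderiv_conjugateOn {c : E → ℝ} {S : Set E} (hS : IsCompact S) (hc : ContinuousOn c S)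
    {v : StrongDual ℝ E} (hv : DifferentiableAt ℝ (conjugateOn c S) v) {x : E} (hxS : x ∈ S)
    (hx : IsMaxOn (fun y => v y - c y) S x) :
    fderiv ℝ (conjugateOn c S) v = NormedSpace.inclusionInDoubleDualLi ℝ x := by
  set J : StrongDual ℝ (StrongDual ℝ E) := NormedSpace.inclusionInDoubleDualLi ℝ x
  have hJ : ∀ w : StrongDual ℝ E, J w = w x := fun _ => rfl
  have hmin : IsLocalMin (fun w => conjugateOn c S w - J w) v := by
    refine Filter.Eventually.of_forall fun w => ?_
    have := le_conjugateOn hS hc w hxS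
    simp only [hJ, conjugateOn_eq hxS hx]
    linarith
  exact sub_eq_zero.1 (hmin.hasFDerivAt_eq_zero (hv.hasFDerivAt.sub J.hasFDerivAt))

/-! ### Almost-everywhere uniqueness and averages over the dual ball -/

variable [FiniteDimensional ℝ E]

theorem ae_dualBallMeasure {p : StrongDual ℝ E → Prop}
    (h : ∀ᵐ v ∂(Measure.addHaar : Measure (StrongDual ℝ E)), p v) :
    ∀ᵐ v ∂(dualBallMeasure E), p v :=
  ae_restrict_of_ae h

theorem ae_norm_lt_one : ∀ᵐ v : StrongDual ℝ E ∂(dualBallMeasure E), ‖v‖ < 1 := by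
  have hsph : ∀ᵐ v ∂(Measure.addHaar : Measure (StrongDual ℝ E)),
      v ∉ sphere (0 : StrongDual ℝ E) 1 :=
    measure_eq_zero_iff_ae_notMem.1 (Measure.addHaar_sphere_of_ne_zero _ 0 one_ne_zero)
  filter_upwards [ae_dualBallMeasure hsph, ae_restrict_mem isClosed_closedBall.measurableSet]
    with v hv hv'
  simp only [mem_sphere_iff_norm, mem_closedBall_iff_norm, sub_zero] at hv hv'
  exact lt_of_le_of_ne hv' hv

instance : IsFiniteMeasure (dualBallMeasure E) :=
  isFiniteMeasure_restrict.2 (isCompact_closedBall 0 1).measure_lt_top.ne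

instance : NeZero (dualBallMeasure E) :=
  ⟨by
    rw [dualBallMeasure, Ne, Measure.restrict_eq_zero]
    exact (measure_closedBall_pos _ 0 one_pos).ne'⟩

section

variable {c : E → ℝ} {S : Set E} (hS : IsCompact S) (hne : S.Nonempty) (hc : ContinuousOn c S)
include hS hne hc

theorem ae_differentiableAt_conjugateOn :
    ∀ᵐ v ∂(dualBallMeasure E), DifferentiableAt ℝ (conjugateOn c S) v := by
  obtain ⟨C, hC⟩ := exists_lipschitzWith_conjugateOn hS hne
  exact ae_dualBallMeasure (hC c hc).ae_differentiableAt

/-- In almost every direction the maximizer of `v - c` over a compact set is unique. -/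
theorem ae_existsUnique_isMaxOn_sub :
    ∀ᵐ v : StrongDual ℝ E ∂(dualBallMeasure E),
      ∃! x, x ∈ S ∧ IsMaxOn (fun y => v y - c y) S x := by
  filter_upwards [ae_differentiableAt_conjugateOn hS hne hc] with v hv
  obtain ⟨x, hxS, hx⟩ := exists_isMaxOn_sub hS hne hc v
  -- Any two maximizers have the same image in the bidual, namely the derivative.
  refine ⟨x, ⟨hxS, hx⟩, fun y hy => (NormedSpace.inclusionInDoubleDualLi ℝ).injective ?_⟩
  rw [← fderiv_conjugateOn hS hc hv hxS hx, ← fderiv_conjugateOn hS hc hv hy.1 hy.2]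

/-- Measurability of the chosen maximizer comes from its a.e. equality with a derivative. -/
theorem integrable_of_isMaxOn_sub {p : StrongDual ℝ E → E}
    (hp : ∀ᵐ v ∂(dualBallMeasure E), p v ∈ S ∧ IsMaxOn (fun y => v y - c y) S (p v)) :
    Integrable p (dualBallMeasure E) := by
  obtain ⟨M, hM⟩ := hS.isBounded.exists_norm_le
  refine Integrable.of_bound (C := M) ?_ (hp.mono fun v hv => hM _ hv.1)
  rw [← (NormedSpace.inclusionInDoubleDualLi ℝ (E := E)).isometry.isEmbedding
    |>.aestronglyMeasurable_comp_iff]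
  refine (measurable_fderiv ℝ (conjugateOn c S)).aestronglyMeasurable.congr ?_
  filter_upwards [hp, ae_differentiableAt_conjugateOn hS hne hc] with v hv hd
  exact fderiv_conjugateOn hS hc hd hv.1 hv.2

end

/-- The average of the maximizer of `v - c` over `S` depends only on the values of the conjugate
function on the dual unit sphere. -/
theorem average_eq_of_conjugateOn_eq {c₁ c₂ : E → ℝ} {S : Set E} (hS : IsCompact S)
    (hne : S.Nonempty) (hc₁ : ContinuousOn c₁ S) (hc₂ : ContinuousOn c₂ S)
    {p₁ p₂ : StrongDual ℝ E → E}
    (hp₁ : ∀ᵐ v ∂(dualBallMeasure E), p₁ v ∈ S ∧ IsMaxOn (fun y => v y - c₁ y) S (p₁ v))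
    (hp₂ : ∀ᵐ v ∂(dualBallMeasure E), p₂ v ∈ S ∧ IsMaxOn (fun y => v y - c₂ y) S (p₂ v))
    (heq : ∀ v : StrongDual ℝ E, ‖v‖ = 1 → conjugateOn c₁ S v = conjugateOn c₂ S v) :
    ⨍ v, p₁ v ∂(dualBallMeasure E) = ⨍ v, p₂ v ∂(dualBallMeasure E) := by
  have hi₁ := integrable_of_isMaxOn_sub hS hne hc₁ hp₁
  have hi₂ := integrable_of_isMaxOn_sub hS hne hc₂ hp₂
  obtain ⟨C, hC⟩ := exists_lipschitzWith_conjugateOn hS hne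
  rw [average_eq, average_eq]
  congr 1
  rw [← sub_eq_zero, ← integral_sub hi₁ hi₂]
  -- A test functional `φ` on `E` is also a direction in the dual, and there the derivative of the
  -- difference of conjugates is `φ (p₁ v - p₂ v)`.
  refine (SeparatingDual.eq_zero_iff_forall_dual_eq_zero (R := ℝ) _).2 fun φ => ?_
  have hcomm : ∫ v, φ (p₁ v - p₂ v) ∂(dualBallMeasure E) =
      φ (∫ v, (p₁ v - p₂ v) ∂(dualBallMeasure E)) := φ.integral_comp_comm (hi₁.sub hi₂)
  rw [← hcomm]
  have hlip := (hC c₁ hc₁).sub (hC c₂ hc₂)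
  rw [← hlip.setIntegral_lineDeriv_closedBall_eq_zero (μ := Measure.addHaar)
    (fun v hv => sub_eq_zero.2 (heq v hv)) φ]
  refine integral_congr_ae ?_
  filter_upwards [hp₁, hp₂, ae_differentiableAt_conjugateOn hS hne hc₁,
    ae_differentiableAt_conjugateOn hS hne hc₂] with v h₁ h₂ d₁ d₂
  rw [(d₁.fun_sub d₂).lineDeriv_eq_fderiv, fderiv_fun_sub d₁ d₂,
    fderiv_conjugateOn hS hc₁ d₁ h₁.1 h₁.2, fderiv_conjugateOn hS hc₂ d₂ h₂.1 h₂.2]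
  exact map_sub φ _ _

/-! ### Level sets and Steiner points -/

theorem exists_norm_le_one_apply_eq_norm (v : StrongDual ℝ E) : ∃ u : E, ‖u‖ ≤ 1 ∧ ‖v‖ ≤ v u := by
  obtain ⟨u, hu, hmax⟩ := (isCompact_closedBall (0 : E) 1).exists_isMaxOn
    ⟨0, by simp⟩ v.continuous.continuousOn
  refine ⟨u, by simpa using hu, ?_⟩
  by_contra! hlt
  obtain ⟨x, hx, hvx⟩ := v.exists_lt_apply_of_lt_opNorm hlt
  have h1 : v x ≤ v u := hmax (by simpa using hx.le)
  have h2 : v (-x) ≤ v u := hmax (by simpa using hx.le)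
  rw [map_neg] at h2
  exact absurd (abs_le'.2 ⟨h1, h2⟩) (not_le.2 hvx)

/-- On the dual unit sphere the conjugate of a `1`-Lipschitz function over one of its level sets is
the support function of the level set, up to a constant. -/
theorem conjugateOn_levelSet_eq {W : E → ℝ} (hW : LipschitzWith 1 W) {R : ℝ}
    (hS : IsCompact {x | W x ≤ R}) (hne : {x | W x ≤ R}.Nonempty) {v : StrongDual ℝ E}
    (hv : ‖v‖ = 1) :
    conjugateOn W {x | W x ≤ R} v = conjugateOn (fun _ => R) {x | W x ≤ R} v := by
  apply le_antisymm
  · obtain ⟨x, hxS, hx⟩ := exists_isMaxOn_sub hS hne hW.continuous.continuousOn v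
    obtain ⟨u, hu, hvu⟩ := exists_norm_le_one_apply_eq_norm v
    have hxR : 0 ≤ R - W x := sub_nonneg.2 hxS
    -- Moving by `R - W x` along a norming vector `u` stays in the level set and raises `v` by at
    -- least `R - W x`.
    have hmem : x + (R - W x) • u ∈ {x | W x ≤ R} := by
      have h1 := hW.le_add_mul (x + (R - W x) • u) x
      rw [dist_self_add_left, norm_smul, Real.norm_of_nonneg hxR, NNReal.coe_one, one_mul] at h1
      have h2 := mul_le_of_le_one_right hxR hu
      change W _ ≤ R
      linarith
    have h := le_conjugateOn hS continuousOn_const v hmem (c := fun _ => R)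
    rw [conjugateOn_eq hxS hx]
    simp only [map_add, map_smul, smul_eq_mul] at h
    have := le_mul_of_one_le_right hxR (hv ▸ hvu)
    linarith
  · obtain ⟨x, hxS, hx⟩ :=
      exists_isMaxOn_sub hS hne (continuousOn_const (c := R)) v
    rw [conjugateOn_eq hxS hx]
    have h := le_conjugateOn hS hW.continuous.continuousOn v hxS
    have hxR : W x ≤ R := hxS
    linarith

/-- Subtracting the constant `R` leaves maximizers unchanged and makes the support function
comparable with the conjugate of `W`. -/
theorem steinerWellDefined_of_isCompact {S : Set E} (hS : IsCompact S) (hne : S.Nonempty) (R : ℝ) :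
    SteinerWellDefined S ∧ ∀ᵐ v ∂(dualBallMeasure E), extremalPoint S v ∈ S ∧
      IsMaxOn (fun y => v y - R) S (extremalPoint S v) := by
  have hiff : ∀ (v : StrongDual ℝ E) (x : E),
      IsMaxOn (fun y => v y - R) S x ↔ IsMaxOn v S x := fun v x => by
    simp only [isMaxOn_iff, sub_le_sub_iff_right]
  have hu := ae_existsUnique_isMaxOn_sub hS hne (continuousOn_const (c := R))
  simp only [hiff] at hu
  have hp : ∀ᵐ v ∂(dualBallMeasure E), extremalPoint S v ∈ S ∧
      IsMaxOn (fun y => v y - R) S (extremalPoint S v) := by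
    filter_upwards [hu] with v hv
    rw [hiff]
    exact Classical.epsilon_spec (p := fun x => x ∈ S ∧ IsMaxOn v S x) hv.exists
  exact ⟨⟨hu, integrable_of_isMaxOn_sub hS hne continuousOn_const hp⟩, hp⟩

theorem functionalSteinerWellDefined_of_isMinOn_iff {S : Set E} (hS : IsCompact S)
    (hne : S.Nonempty) {c V : E → ℝ} (hc : ContinuousOn c S)
    (hV : ∀ v : StrongDual ℝ E, ‖v‖ < 1 → ∀ y, IsMinOn (fun w => V w - v w) univ y ↔
      y ∈ S ∧ IsMaxOn (fun w => v w - c w) S y) :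
    FunctionalSteinerWellDefined V ∧ ∀ᵐ v ∂(dualBallMeasure E), conjugatePoint V v ∈ S ∧
      IsMaxOn (fun y => v y - c y) S (conjugatePoint V v) := by
  have hu : ∀ᵐ v : StrongDual ℝ E ∂(dualBallMeasure E),
      ∃! x, IsMinOn (fun w => V w - v w) univ x := by
    filter_upwards [ae_existsUnique_isMaxOn_sub hS hne hc, ae_norm_lt_one] with v hv hv1
    simpa only [hV v hv1] using hv
  have hp : ∀ᵐ v ∂(dualBallMeasure E), conjugatePoint V v ∈ S ∧
      IsMaxOn (fun y => v y - c y) S (conjugatePoint V v) := by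
    filter_upwards [hu, ae_norm_lt_one] with v hv hv1
    rw [← hV v hv1]
    exact Classical.epsilon_spec (p := fun x => IsMinOn (fun w => V w - v w) univ x) hv.exists
  exact ⟨⟨hu, integrable_of_isMaxOn_sub hS hne hc hp⟩, hp⟩

end ConvexChasing

end

theorem mainTheorem6 {E : Type*} [NormedAddCommGroup E] [NormedSpace ℝ E] [FiniteDimensional ℝ E]
    (t : ℕ) (ht : 1 ≤ t) (K : ℕ → Set E) (f : ℕ → E → ℝ)
    (hKclosed : ∀ n, 1 ≤ n → n ≤ t → IsClosed (K n))
    (hKconvex : ∀ n, 1 ≤ n → n ≤ t → Convex ℝ (K n))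
    (hKnonempty : ∀ n, 1 ≤ n → n ≤ t → (K n).Nonempty)
    (hfconvex : ∀ n, 1 ≤ n → n ≤ t → ConvexOn ℝ Set.univ (f n))
    (hfnonneg : ∀ n, 1 ≤ n → n ≤ t → ∀ x, 0 ≤ f n x)
    (R : ℝ) (hR : (⨅ x, ConvexChasing.workFunction K f t x) ≤ R) :
    (ConvexChasing.SteinerWellDefined (ConvexChasing.levelSet K f t R) ∧
      ConvexChasing.FunctionalSteinerWellDefined
        (ConvexChasing.workFunctionAfter K f t (ConvexChasing.levelSet K f t R)) ∧
      ConvexChasing.steinerPoint (ConvexChasing.levelSet K f t R) =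
        ConvexChasing.functionalSteinerPoint
          (ConvexChasing.workFunctionAfter K f t (ConvexChasing.levelSet K f t R)) ∧
      ConvexChasing.functionalSteinerPoint
        (ConvexChasing.workFunctionAfter K f t (ConvexChasing.levelSet K f t R)) ∈ K t) ∧
    ((∀ s, 1 ≤ s → s ≤ t → K s ⊆ ConvexChasing.levelSet K f t R) →
      ConvexChasing.FunctionalSteinerWellDefined (ConvexChasing.workFunction K f t) ∧
      ConvexChasing.steinerPoint (ConvexChasing.levelSet K f t R) =
        ConvexChasing.functionalSteinerPoint (ConvexChasing.workFunction K f t)) := by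
  obtain ⟨t, rfl⟩ : ∃ m, t = m + 1 := ⟨t - 1, by omega⟩
  have hconv := ConvexChasing.isInfConvNorm_workFunction_succ hKnonempty hfnonneg
  have hcoer := ConvexChasing.norm_le_workFunction hKnonempty hfnonneg
  set W := ConvexChasing.workFunction K f (t + 1)
  have hlip : LipschitzWith 1 W := hconv.lipschitzWith
  have hΩ : ConvexChasing.levelSet K f (t + 1) R = {x | W x ≤ R} := rfl
  rw [hΩ]
  have hcl : IsClosed {x | W x ≤ R} := isClosed_le hlip.continuous continuous_const
  have hcpt : IsCompact {x | W x ≤ R} :=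
    (isCompact_closedBall (0 : E) R).of_isClosed_subset hcl fun x hx => by
      simpa using (hcoer x).trans hx
  have hne : {x | W x ≤ R}.Nonempty := by
    -- Coercivity makes the infimum in `hR` attained.
    obtain ⟨x, hx⟩ := hlip.continuous.exists_forall_le
      (Filter.tendsto_atTop_mono hcoer tendsto_norm_cocompact_atTop)
    exact ⟨x, (le_ciInf hx).trans hR⟩
  have hKt : IsClosed (K (t + 1)) := hKclosed _ ht le_rfl
  have hafter := ConvexChasing.isInfConvNorm_workFunctionAfter hKnonempty hfnonneg hne
  obtain ⟨hwd, hext⟩ := ConvexChasing.steinerWellDefined_of_isCompact hcpt hne R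
  obtain ⟨hwdA, hconjA⟩ := ConvexChasing.functionalSteinerWellDefined_of_isMinOn_iff hcpt hne
    hlip.continuous.continuousOn fun v hv y => hafter.isMinOn_iff hcl hlip hv
  have heq {p : StrongDual ℝ E → E} (hp : ∀ᵐ v ∂(ConvexChasing.dualBallMeasure E),
      p v ∈ {x | W x ≤ R} ∧ IsMaxOn (fun y => v y - W y) {x | W x ≤ R} (p v)) :
      ConvexChasing.steinerPoint {x | W x ≤ R} = ⨍ v, p v ∂(ConvexChasing.dualBallMeasure E) :=
    ConvexChasing.average_eq_of_conjugateOn_eq hcpt hne continuousOn_const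
      hlip.continuous.continuousOn hext hp
      fun v hv => (ConvexChasing.conjugateOn_levelSet_eq hlip hcpt hne hv).symm
  refine ⟨⟨hwd, hwdA, heq hconjA, ?_⟩, fun hsub => ?_⟩
  · refine (hKconvex _ ht le_rfl).average_mem hKt ?_ hwdA.2
    filter_upwards [hconjA, ConvexChasing.ae_norm_lt_one] with v hv hv1
    exact hconv.mem_of_isMaxOn_levelSet hKt hv1 hv.1 hv.2
  · obtain ⟨hwdW, hconjW⟩ := ConvexChasing.functionalSteinerWellDefined_of_isMinOn_iff hcpt hne
      hlip.continuous.continuousOn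
      fun v hv y => hconv.isMinOn_iff_levelSet hKt (hsub _ ht le_rfl) hv
    exact ⟨hwdW, heq hconjW⟩
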